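/- Let $m_1,m_2,m_3,m_4>0$ be arbitrary masses and let $M=m_1+m_2+m_3+m_4$. For $\mathbf r=(r_{12},r_{13},r_{14},r_{23},r_{24},r_{34})\in\mathbb R^6$ put $$I(\mathbf r)=\frac1{2M}\sum_{1\le i<j\le 4}m_im_jr_{ij}^2,\qquad F(\mathbf r)=2r_{12}r_{34}-r_{13}^2-r_{24}^2+r_{23}^2+r_{14}^2,$$ and, when all $r_{ij}>0$, let $U(\mathbf r)=\sum_{1\le i<j\le4}\frac{m_im_j}{r_{ij}}$ be the Newtonian potential. Let $$\mathcal M^+=\{\mathbf r\in\mathbb R^6 : r_{ij}>0 \text{ for all } i<j,\ I(\mathbf r)-1=0,\ F(\mathbf r)=0\}.$$ Then the restriction $U|_{\mathcal M^+}$ has exactly one critical point on $\mathcal M^+$; that is, there is exactly one $\mathbf r\in\mathcal M^+$ at which the orthogonal projection of $\nabla U(\mathbf r)$ onto the tangent space $T_{\mathbf r}\mathcal M^+=\{\mathbf v\in\mathbb R^6:\nabla (I-1)(\mathbf r)\cdot\mathbf v=0,\ \nabla F(\mathbf r)\cdot\mathbf v=0\}$ vanishes. -/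

import Mathlib

noncomputable section

namespace TrapezoidalCC

/-- The space of vectors of mutual distances, with its Euclidean structure.  The coordinates
`0, …, 5` of `r` are `(r₁₂, r₁₃, r₁₄, r₂₃, r₂₄, r₃₄)`. -/
abbrev DistVec : Type := EuclideanSpace ℝ (Fin 6)

/-- The distance `r₁₂`. -/
abbrev r12 (r : DistVec) : ℝ := r 0
/-- The distance `r₁₃`. -/
abbrev r13 (r : DistVec) : ℝ := r 1
/-- The distance `r₁₄`. -/
abbrev r14 (r : DistVec) : ℝ := r 2
/-- The distance `r₂₃`. -/
abbrev r23 (r : DistVec) : ℝ := r 3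
/-- The distance `r₂₄`. -/
abbrev r24 (r : DistVec) : ℝ := r 4
/-- The distance `r₃₄`. -/
abbrev r34 (r : DistVec) : ℝ := r 5

/-- The Newtonian potential `U(r) = ∑_{i<j} mᵢ mⱼ / rᵢⱼ`, with masses
`(m₁, m₂, m₃, m₄) = (m 0, m 1, m 2, m 3)`.  It is used only where all `rᵢⱼ > 0`. -/
def potential (m : Fin 4 → ℝ) (r : DistVec) : ℝ :=
  m 0 * m 1 / r12 r + m 0 * m 2 / r13 r + m 0 * m 3 / r14 r
    + m 1 * m 2 / r23 r + m 1 * m 3 / r24 r + m 2 * m 3 / r34 r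

/-- The moment of inertia `I(r) = (1 / 2M) ∑_{i<j} mᵢ mⱼ rᵢⱼ²`, with `M` the total mass. -/
def inertia (m : Fin 4 → ℝ) (r : DistVec) : ℝ :=
  1 / (2 * ∑ i, m i) *
    (m 0 * m 1 * r12 r ^ 2 + m 0 * m 2 * r13 r ^ 2 + m 0 * m 3 * r14 r ^ 2
      + m 1 * m 2 * r23 r ^ 2 + m 1 * m 3 * r24 r ^ 2 + m 2 * m 3 * r34 r ^ 2)

/-- The trapezoid function `F(r) = 2 r₁₂ r₃₄ - r₁₃² - r₂₄² + r₂₃² + r₁₄²`. -/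
def trapezoidF (r : DistVec) : ℝ :=
  2 * r12 r * r34 r - r13 r ^ 2 - r24 r ^ 2 + r23 r ^ 2 + r14 r ^ 2

/-- The set `M⁺` of vectors with positive coordinates that satisfy `I = 1` and `F = 0`. -/
def MPlus (m : Fin 4 → ℝ) : Set DistVec :=
  {r | (∀ i, 0 < r i) ∧ inertia m r - 1 = 0 ∧ trapezoidF r = 0}

/-- The tangent space of `M⁺` at `r`: the vectors orthogonal to the gradients of the two
constraints `I - 1` and `F`. -/
def tangentSpace (m : Fin 4 → ℝ) (r : DistVec) : Submodule ℝ DistVec :=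
  (Submodule.span ℝ {gradient (fun x => inertia m x - 1) r, gradient trapezoidF r})ᗮ

/-- The gradient at `r` of the restriction of `U` to `M⁺`: the orthogonal projection of the
gradient of `U` onto the tangent space of `M⁺`. -/
def restrictedGradient (m : Fin 4 → ℝ) (r : DistVec) : DistVec :=
  (tangentSpace m r).starProjection (gradient (potential m) r)

/-- `r` is a critical point of the restriction of `U` to `M⁺`. -/
def IsCriticalPoint (m : Fin 4 → ℝ) (r : DistVec) : Prop :=
  r ∈ MPlus m ∧ restrictedGradient m r = 0

end TrapezoidalCC

end

namespace TrapezoidalCC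

/-! By homogeneity the multiplier `L` can be scaled to 1. With `w = h r₁₂ r₃₄`, the Lagrange
equations then decouple into one-variable equations: `A(1 - x³) = w x` for `r₁₂, r₃₄`, and `(A ± h)
x³ = A` for the other four, with minus for the diagonals `r₁₃, r₂₄`. As `w ≥ 0` grows, `r₁₂, r₃₄`
shrink, so `h = w / (r₁₂ r₃₄)` grows, the diagonals grow and `r₂₃, r₁₄` shrink. Hence `F` is
monotone along this curve, which gives uniqueness (`IsLagrangePoint.coord_le`); a sign change of `F`
gives existence (`exists_trapezoid_balance`). The condition `I = 1` fixes the scale. -/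

/-- The Lagrange equations `∇U = α ∇I + β ∇F` together with `F = 0`, with denominators cleared,
in terms of the multipliers `L = -α / M` and `h = -2 β`. -/
structure IsLagrangePoint (m : Fin 4 → ℝ) (L h : ℝ) (r : DistVec) : Prop where
  pos : ∀ i, 0 < r i
  trapezoid : trapezoidF r = 0
  eq12 : m 0 * m 1 * (1 - L * r 0 ^ 3) = h * r 5 * r 0 ^ 2
  eq34 : m 2 * m 3 * (1 - L * r 5 ^ 3) = h * r 0 * r 5 ^ 2
  eq13 : m 0 * m 2 * (1 - L * r 1 ^ 3) = -h * r 1 ^ 3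
  eq24 : m 1 * m 3 * (1 - L * r 4 ^ 3) = -h * r 4 ^ 3
  eq23 : m 1 * m 2 * (1 - L * r 3 ^ 3) = h * r 3 ^ 3
  eq14 : m 0 * m 3 * (1 - L * r 2 ^ 3) = h * r 2 ^ 3

/-! ### Gradients -/

theorem hasGradientAt_of_hasFDerivAt_sum_proj {n : ℕ} {f : EuclideanSpace ℝ (Fin n) → ℝ}
    {f' : EuclideanSpace ℝ (Fin n) →L[ℝ] ℝ} {g r : EuclideanSpace ℝ (Fin n)}
    (hf : HasFDerivAt f f' r) (hg : ∀ v, f' v = ∑ i, g i * v i) : HasGradientAt f g r := by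
  rw [hasGradientAt_iff_hasFDerivAt]
  refine hf.congr_fderiv ?_
  ext v
  simp [hg, PiLp.inner_apply, mul_comm]

theorem hasFDerivAt_coord {n : ℕ} (i : Fin n) (r : EuclideanSpace ℝ (Fin n)) :
    HasFDerivAt (fun x : EuclideanSpace ℝ (Fin n) => x i)
      (EuclideanSpace.proj i : EuclideanSpace ℝ (Fin n) →L[ℝ] ℝ) r :=
  (EuclideanSpace.proj i : EuclideanSpace ℝ (Fin n) →L[ℝ] ℝ).hasFDerivAt

theorem hasGradientAt_trapezoidF (r : DistVec) :
    HasGradientAt trapezoidF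
      !₂[2 * r 5, 2 * -r 1, 2 * r 2, 2 * r 3, 2 * -r 4, 2 * r 0] r := by
  have c := fun i => hasFDerivAt_coord i r
  refine hasGradientAt_of_hasFDerivAt_sum_proj
    ((((((c 0).const_mul 2).mul (c 5)).sub ((c 1).pow 2)).sub ((c 4).pow 2)).add
      ((c 3).pow 2)|>.add ((c 2).pow 2)) fun v => ?_
  simp [Fin.sum_univ_succ]
  ring

theorem hasGradientAt_inertia (m : Fin 4 → ℝ) (r : DistVec) :
    HasGradientAt (fun x => inertia m x - 1)
      ((∑ i, m i)⁻¹ • !₂[m 0 * m 1 * r 0, m 0 * m 2 * r 1, m 0 * m 3 * r 2,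
        m 1 * m 2 * r 3, m 1 * m 3 * r 4, m 2 * m 3 * r 5]) r := by
  have c := fun i => (hasFDerivAt_coord i r).pow 2
  refine hasGradientAt_of_hasFDerivAt_sum_proj
    ((((((((c 0).const_mul (m 0 * m 1)).add ((c 1).const_mul (m 0 * m 2))).add
      ((c 2).const_mul (m 0 * m 3))).add ((c 3).const_mul (m 1 * m 2))).add
      ((c 4).const_mul (m 1 * m 3))).add ((c 5).const_mul (m 2 * m 3))).const_mul
      (1 / (2 * ∑ i, m i))|>.sub_const 1) fun v => ?_
  generalize ∑ i, m i = M
  simp [Fin.sum_univ_succ]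
  ring

theorem hasGradientAt_potential (m : Fin 4 → ℝ) {r : DistVec} (hr : ∀ i, 0 < r i) :
    HasGradientAt (potential m)
      !₂[-(m 0 * m 1) / r 0 ^ 2, -(m 0 * m 2) / r 1 ^ 2, -(m 0 * m 3) / r 2 ^ 2,
        -(m 1 * m 2) / r 3 ^ 2, -(m 1 * m 3) / r 4 ^ 2, -(m 2 * m 3) / r 5 ^ 2] r := by
  have c : ∀ (a : ℝ) (i : Fin 6), HasFDerivAt (fun x : DistVec => a / x i)
      ((-a / r i ^ 2) • (EuclideanSpace.proj i : DistVec →L[ℝ] ℝ)) r := fun a i => by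
    have h := (((hasDerivAt_inv (hr i).ne').comp_hasFDerivAt r
      (hasFDerivAt_coord i r)).const_mul a)
    refine h.congr_fderiv ?_
    ext v
    simp
    ring
  refine hasGradientAt_of_hasFDerivAt_sum_proj
    ((((((c (m 0 * m 1) 0).add (c (m 0 * m 2) 1)).add (c (m 0 * m 3) 2)).add
      (c (m 1 * m 2) 3)).add (c (m 1 * m 3) 4)).add (c (m 2 * m 3) 5)) fun v => ?_
  simp [Fin.sum_univ_succ]
  ring

/-- A finite-dimensional span is its own double orthogonal complement, so the two constraint
gradients need not be independent. -/
theorem restrictedGradient_eq_zero_iff (m : Fin 4 → ℝ) (r : DistVec) :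
    restrictedGradient m r = 0 ↔
      ∃ α β : ℝ, α • gradient (fun x => inertia m x - 1) r + β • gradient trapezoidF r =
        gradient (potential m) r := by
  unfold restrictedGradient
  rw [Submodule.starProjection_apply_eq_zero_iff]
  unfold tangentSpace
  rw [Submodule.orthogonal_orthogonal, Submodule.mem_span_pair]

/-- One coordinate of the Lagrange system. Here `2y` is the partial derivative of `F`: `y` is the
other parallel side, `-x` for a diagonal, `x` for a leg. -/
theorem lagrange_coord_iff {A L M h α β x y : ℝ} (hx : 0 < x) (hM : 0 < M) (hα : α = -L * M)
    (hβ : β = -h / 2) :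
    α * (M⁻¹ * (A * x)) + β * (2 * y) = -A / x ^ 2 ↔ A * (1 - L * x ^ 3) = h * y * x ^ 2 := by
  subst hα hβ
  rw [eq_div_iff (by positivity)]
  have e : (-L * M * (M⁻¹ * (A * x)) + -h / 2 * (2 * y)) * x ^ 2 =
      -L * A * x ^ 3 - h * y * x ^ 2 := by
    field_simp
    ring
  rw [e]
  constructor <;> intro h <;> linarith

theorem isCriticalPoint_iff {m : Fin 4 → ℝ} (hm : ∀ i, 0 < m i) (r : DistVec) :
    IsCriticalPoint m r ↔ inertia m r = 1 ∧ ∃ L h, IsLagrangePoint m L h r := by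
  have hM : 0 < ∑ i, m i := Finset.sum_pos (fun i _ => hm i) Finset.univ_nonempty
  rw [IsCriticalPoint, restrictedGradient_eq_zero_iff]
  constructor
  · rintro ⟨⟨hr, hI, hF⟩, α, β, h⟩
    rw [(hasGradientAt_inertia m r).gradient, (hasGradientAt_trapezoidF r).gradient,
      (hasGradientAt_potential m hr).gradient] at h
    have key : ∀ {A x y : ℝ}, 0 < x →
        α * ((∑ i, m i)⁻¹ * (A * x)) + β * (2 * y) = -A / x ^ 2 →
        A * (1 - (-α / ∑ i, m i) * x ^ 3) = (-2 * β) * y * x ^ 2 := fun hx =>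
      (lagrange_coord_iff hx hM (by field_simp) (by ring)).1
    have h0 := key (hr 0) (congrArg (fun v : DistVec => v 0) h)
    have h1 := key (hr 1) (congrArg (fun v : DistVec => v 1) h)
    have h2 := key (hr 2) (congrArg (fun v : DistVec => v 2) h)
    have h3 := key (hr 3) (congrArg (fun v : DistVec => v 3) h)
    have h4 := key (hr 4) (congrArg (fun v : DistVec => v 4) h)
    have h5 := key (hr 5) (congrArg (fun v : DistVec => v 5) h)
    exact ⟨by linarith, -α / ∑ i, m i, -2 * β, hr, hF, h0, h5, by rw [h1]; ring,
      by rw [h4]; ring, by rw [h3]; ring, by rw [h2]; ring⟩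
  · rintro ⟨hI, L, h, hr, hF, h0, h5, h1, h4, h3, h2⟩
    refine ⟨⟨hr, by linarith, hF⟩, -L * ∑ i, m i, -h / 2, ?_⟩
    rw [(hasGradientAt_inertia m r).gradient, (hasGradientAt_trapezoidF r).gradient,
      (hasGradientAt_potential m hr).gradient]
    have key : ∀ {A x : ℝ} (y : ℝ), 0 < x → A * (1 - L * x ^ 3) = h * y * x ^ 2 →
        (-L * ∑ i, m i) * ((∑ i, m i)⁻¹ * (A * x)) + (-h / 2) * (2 * y) = -A / x ^ 2 :=
      fun y hx => (lagrange_coord_iff hx hM rfl rfl).2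
    ext i
    fin_cases i
    · exact key (r 5) (hr 0) h0
    · exact key (-r 1) (hr 1) (by rw [h1]; ring)
    · exact key (r 2) (hr 2) (by rw [h2]; ring)
    · exact key (r 3) (hr 3) (by rw [h3]; ring)
    · exact key (-r 4) (hr 4) (by rw [h4]; ring)
    · exact key (r 0) (hr 5) h5

/-! ### Scaling -/

theorem inertia_smul (m : Fin 4 → ℝ) (t : ℝ) (r : DistVec) :
    inertia m (t • r) = t ^ 2 * inertia m r := by
  simp [inertia]
  ring

theorem inertia_pos {m : Fin 4 → ℝ} (hm : ∀ i, 0 < m i) {r : DistVec} (hr : ∀ i, 0 < r i) :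
    0 < inertia m r := by
  have hM : 0 < ∑ i, m i := Finset.sum_pos (fun i _ => hm i) Finset.univ_nonempty
  have h0 := hm 0
  have h1 := hm 1
  have h2 := hm 2
  have h3 := hm 3
  have := hr 0
  have := hr 1
  have := hr 2
  have := hr 3
  have := hr 4
  have := hr 5
  unfold inertia
  positivity

theorem IsLagrangePoint.smul {m : Fin 4 → ℝ} {L h t : ℝ} {r : DistVec}
    (hr : IsLagrangePoint m L h r) (ht : 0 < t) :
    IsLagrangePoint m (L / t ^ 3) (h / t ^ 3) (t • r) := by
  obtain ⟨hp, hF, h1, h2, h3, h4, h5, h6⟩ := hr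
  refine ⟨fun i => by simpa using mul_pos ht (hp i), ?_, ?_, ?_, ?_, ?_, ?_, ?_⟩
  · have : trapezoidF (t • r) = t ^ 2 * trapezoidF r := by
      simp [trapezoidF]
      ring
    rw [this, hF, mul_zero]
  all_goals
    simp only [PiLp.smul_apply, smul_eq_mul]
    field_simp
    linarith

/-- The multiplier `L` of a Lagrange point is positive. -/
theorem IsLagrangePoint.multiplier_pos {m : Fin 4 → ℝ} (hm : ∀ i, 0 < m i) {L h : ℝ}
    {r : DistVec} (hr : IsLagrangePoint m L h r) : 0 < L := by
  obtain ⟨hp, hF, h1, h2, h3, h4, h5, h6⟩ := hr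
  by_contra! hL
  -- If `L ≤ 0`, a diagonal forces `h < 0` while a leg forces `h > 0`.
  have key : ∀ i, 0 < 1 - L * r i ^ 3 := fun i => by
    have := pow_pos (hp i) 3
    nlinarith
  have e1 : 0 < -h * r 1 ^ 3 := h3 ▸ mul_pos (mul_pos (hm 0) (hm 2)) (key 1)
  have e3 : 0 < h * r 3 ^ 3 := h5 ▸ mul_pos (mul_pos (hm 1) (hm 2)) (key 3)
  have := pos_of_mul_pos_left e1 (pow_pos (hp 1) 3).le
  have := pos_of_mul_pos_left e3 (pow_pos (hp 3) 3).le
  linarith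

/-! ### Uniqueness -/

/-- If `h ≤ 0`, the diagonals are at most 1 and all other distances at least 1, so `F ≥ 2 - 1 - 1 +
1 + 1 > 0`. -/
theorem IsLagrangePoint.multiplier_pos_of_normalized {m : Fin 4 → ℝ} (hm : ∀ i, 0 < m i) {h : ℝ}
    {r : DistVec} (hr : IsLagrangePoint m 1 h r) : 0 < h := by
  obtain ⟨hp, hF, h1, h2, h3, h4, h5, h6⟩ := hr
  by_contra! hh
  have le1 : ∀ {A x y : ℝ}, 0 < A → 0 < x → 0 ≤ y → A * (1 - 1 * x ^ 3) = y → x ≤ 1 := by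
    intro A x y hA hx hy e
    by_contra! hx1
    have : 1 < x ^ 3 := one_lt_pow₀ hx1 (by norm_num)
    nlinarith
  have ge1 : ∀ {A x y : ℝ}, 0 < A → 0 < x → y ≤ 0 → A * (1 - 1 * x ^ 3) = y → 1 ≤ x := by
    intro A x y hA hx hy e
    by_contra! hx1
    have : x ^ 3 < 1 := pow_lt_one₀ hx.le hx1 (by norm_num)
    nlinarith
  have hn : ∀ {x : ℝ}, 0 < x → h * x ≤ 0 := fun hx => mul_nonpos_of_nonpos_of_nonneg hh hx.le
  have hp' := fun i => pow_pos (hp i) 3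
  have a := ge1 (mul_pos (hm 0) (hm 1)) (hp 0)
    (by rw [mul_assoc]; exact hn (mul_pos (hp 5) (pow_pos (hp 0) 2))) h1
  have c := ge1 (mul_pos (hm 2) (hm 3)) (hp 5)
    (by rw [mul_assoc]; exact hn (mul_pos (hp 0) (pow_pos (hp 5) 2))) h2
  have p := le1 (mul_pos (hm 0) (hm 2)) (hp 1) (by linarith [hn (hp' 1)]) h3
  have q := le1 (mul_pos (hm 1) (hm 3)) (hp 4) (by linarith [hn (hp' 4)]) h4
  have s := ge1 (mul_pos (hm 1) (hm 2)) (hp 3) (hn (hp' 3)) h5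
  have t := ge1 (mul_pos (hm 0) (hm 3)) (hp 2) (hn (hp' 2)) h6
  simp only [trapezoidF] at hF
  nlinarith [hp 1, hp 4]

theorem le_of_mul_one_sub_cube_eq_mul {A x x' w w' : ℝ} (hA : 0 < A) (hx : 0 < x) (hw : 0 ≤ w)
    (hww : w ≤ w') (e : A * (1 - 1 * x ^ 3) = w * x) (e' : A * (1 - 1 * x' ^ 3) = w' * x') :
    x' ≤ x := by
  by_contra! hlt
  have h3 : x ^ 3 < x' ^ 3 := pow_lt_pow_left₀ hlt hx.le (by norm_num)
  have := mul_le_mul hww hlt.le hx.le (hw.trans hww)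
  have := mul_lt_mul_of_pos_left h3 hA
  linarith

theorem le_of_mul_one_sub_cube_eq_mul_cube {A x x' k k' : ℝ} (hA : 0 < A) (hx : 0 < x)
    (hkk : k ≤ k') (e : A * (1 - 1 * x ^ 3) = k * x ^ 3)
    (e' : A * (1 - 1 * x' ^ 3) = k' * x' ^ 3) : x' ≤ x := by
  by_contra! hlt
  have h3 : x ^ 3 < x' ^ 3 := pow_lt_pow_left₀ hlt hx.le (by norm_num)
  have hx3 := pow_pos hx 3
  have e1 : (A + k) * x ^ 3 = A := by linarith
  have e2 : (A + k') * x' ^ 3 = A := by linarith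
  -- This positivity holds for either sign of `k`, so the lemma serves diagonals (`k = -h`) and legs
  -- (`k = h`).
  have hAk : 0 < A + k := by
    refine pos_of_mul_pos_left ?_ hx3.le
    rwa [e1]
  have := mul_lt_mul_of_pos_left h3 hAk
  have := mul_le_mul_of_nonneg_right (add_le_add_right hkk A) (hx3.trans h3).le
  linarith

/-- The coordinates of a normalized Lagrange point are monotone functions of `h r₁₂ r₃₄`. -/
theorem IsLagrangePoint.coord_le {m : Fin 4 → ℝ} (hm : ∀ i, 0 < m i) {h h' : ℝ} {r r' : DistVec}
    (hr : IsLagrangePoint m 1 h r) (hr' : IsLagrangePoint m 1 h' r')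
    (hw : h * r 0 * r 5 ≤ h' * r' 0 * r' 5) :
    r' 0 ≤ r 0 ∧ r 1 ≤ r' 1 ∧ r' 2 ≤ r 2 ∧ r' 3 ≤ r 3 ∧ r 4 ≤ r' 4 ∧ r' 5 ≤ r 5 := by
  have hh := hr.multiplier_pos_of_normalized hm
  have hp := hr.pos
  have hp' := hr'.pos
  have w0 : 0 ≤ h * r 0 * r 5 := (mul_pos (mul_pos hh (hp 0)) (hp 5)).le
  have a : r' 0 ≤ r 0 := le_of_mul_one_sub_cube_eq_mul (mul_pos (hm 0) (hm 1)) (hp 0) w0 hw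
    (by rw [hr.eq12]; ring) (by rw [hr'.eq12]; ring)
  have c : r' 5 ≤ r 5 := le_of_mul_one_sub_cube_eq_mul (mul_pos (hm 2) (hm 3)) (hp 5) w0 hw
    (by rw [hr.eq34]; ring) (by rw [hr'.eq34]; ring)
  -- The product `r₁₂ r₃₄` does not increase, so a smaller `h'` would make `w` drop.
  have hle : h ≤ h' := by
    by_contra! hlt
    have := mul_lt_mul hlt (mul_le_mul a c (hp' 5).le (hp 0).le) (mul_pos (hp' 0) (hp' 5)) hh.le
    linarith
  exact ⟨a,
    le_of_mul_one_sub_cube_eq_mul_cube (mul_pos (hm 0) (hm 2)) (hp' 1) (neg_le_neg hle)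
      hr'.eq13 hr.eq13,
    le_of_mul_one_sub_cube_eq_mul_cube (mul_pos (hm 0) (hm 3)) (hp 2) hle hr.eq14 hr'.eq14,
    le_of_mul_one_sub_cube_eq_mul_cube (mul_pos (hm 1) (hm 2)) (hp 3) hle hr.eq23 hr'.eq23,
    le_of_mul_one_sub_cube_eq_mul_cube (mul_pos (hm 1) (hm 3)) (hp' 4) (neg_le_neg hle)
      hr'.eq24 hr.eq24,
    c⟩

theorem IsLagrangePoint.unique_of_normalized {m : Fin 4 → ℝ} (hm : ∀ i, 0 < m i) {h h' : ℝ}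
    {r r' : DistVec} (hr : IsLagrangePoint m 1 h r) (hr' : IsLagrangePoint m 1 h' r') :
    r = r' := by
  wlog hw : h * r 0 * r 5 ≤ h' * r' 0 * r' 5 generalizing h h' r r'
  · exact (this hr' hr (le_of_not_ge hw)).symm
  obtain ⟨a, p, t, s, q, c⟩ := hr.coord_le hm hr' hw
  have hp := hr.pos
  have hp' := hr'.pos
  have hF := hr.trapezoid
  have hF' := hr'.trapezoid
  have ac := mul_le_mul a c (hp' 5).le (hp 0).le
  have p2 := pow_le_pow_left₀ (hp 1).le p 2
  have q2 := pow_le_pow_left₀ (hp 4).le q 2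
  have s2 := pow_le_pow_left₀ (hp' 3).le s 2
  have t2 := pow_le_pow_left₀ (hp' 2).le t 2
  simp only [trapezoidF] at hF hF'
  have eq_of_sq : ∀ {x y : ℝ}, 0 < x → 0 < y → x ^ 2 = y ^ 2 → x = y := fun hx hy e =>
    (pow_left_inj₀ hx.le hy.le two_ne_zero).1 e
  -- All terms of `F` move in the same direction while `F` stays 0, so each term is unchanged.
  have ac' : r' 0 * r' 5 = r 0 * r 5 := by linarith
  obtain ⟨e0, e5⟩ := (mul_eq_mul_iff_eq_and_eq_of_pos a c (hp' 0) (hp 5)).1 ac'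
  have e1 := eq_of_sq (hp 1) (hp' 1) (by linarith)
  have e2 := eq_of_sq (hp 2) (hp' 2) (by linarith)
  have e3 := eq_of_sq (hp 3) (hp' 3) (by linarith)
  have e4 := eq_of_sq (hp 4) (hp' 4) (by linarith)
  ext i
  fin_cases i
  exacts [e0.symm, e1, e2, e3, e4, e5.symm]

theorem IsLagrangePoint.exists_normalized {m : Fin 4 → ℝ} (hm : ∀ i, 0 < m i) {L h : ℝ}
    {r : DistVec} (hr : IsLagrangePoint m L h r) :
    ∃ t k : ℝ, 0 < t ∧ IsLagrangePoint m 1 k (t • r) := by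
  have hL := hr.multiplier_pos hm
  refine ⟨L ^ (1 / 3 : ℝ), h / L, by positivity, ?_⟩
  have e : (L ^ (1 / 3 : ℝ)) ^ 3 = L := by
    rw [← Real.rpow_natCast, ← Real.rpow_mul hL.le]
    norm_num
  have := hr.smul (t := L ^ (1 / 3 : ℝ)) (by positivity)
  rwa [e, div_self hL.ne'] at this

theorem IsCriticalPoint.unique {m : Fin 4 → ℝ} (hm : ∀ i, 0 < m i) {r r' : DistVec}
    (hr : IsCriticalPoint m r) (hr' : IsCriticalPoint m r') : r = r' := by
  obtain ⟨hI, L, h, hL⟩ := (isCriticalPoint_iff hm r).1 hr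
  obtain ⟨hI', L', h', hL'⟩ := (isCriticalPoint_iff hm r').1 hr'
  obtain ⟨t, k, ht, hk⟩ := hL.exists_normalized hm
  obtain ⟨t', k', ht', hk'⟩ := hL'.exists_normalized hm
  have e := hk.unique_of_normalized hm hk'
  have hsq : t ^ 2 = t' ^ 2 := by
    have := congrArg (inertia m) e
    rwa [inertia_smul, inertia_smul, hI, hI', mul_one, mul_one] at this
  obtain rfl : t = t' := (pow_left_inj₀ ht.le ht'.le two_ne_zero).1 hsq
  exact smul_right_injective _ ht.ne' e

/-! ### Existence -/

theorem exists_cubic_root {y : ℝ} (hy : 0 ≤ y) : ∃ x : ℝ, 0 < x ∧ x ≤ 1 ∧ x ^ 3 + y * x = 1 := by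
  have hc : ContinuousOn (fun x : ℝ => x ^ 3 + y * x) (Set.Icc 0 1) := by fun_prop
  obtain ⟨x, ⟨hx0, hx1⟩, hx⟩ := intermediate_value_Icc zero_le_one hc
    (show (1 : ℝ) ∈ Set.Icc _ _ by constructor <;> simp [hy])
  refine ⟨x, lt_of_le_of_ne hx0 ?_, hx1, hx⟩
  rintro rfl
  simp at hx

/-- The solution `x > 0` of `x ^ 3 + y * x = 1`, for `y ≥ 0` (extended by `1` to `y < 0`). -/
noncomputable def cubicRoot (y : ℝ) : ℝ := (exists_cubic_root (le_max_right y 0)).choose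

theorem cubicRoot_pos (y : ℝ) : 0 < cubicRoot y :=
  (exists_cubic_root (le_max_right y 0)).choose_spec.1

theorem cubicRoot_le_one (y : ℝ) : cubicRoot y ≤ 1 :=
  (exists_cubic_root (le_max_right y 0)).choose_spec.2.1

theorem cubicRoot_spec' (y : ℝ) : cubicRoot y ^ 3 + max y 0 * cubicRoot y = 1 :=
  (exists_cubic_root (le_max_right y 0)).choose_spec.2.2

theorem cubicRoot_spec {y : ℝ} (hy : 0 ≤ y) : cubicRoot y ^ 3 + y * cubicRoot y = 1 := by
  simpa [hy] using cubicRoot_spec' y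

theorem cubicRoot_antitone : Antitone cubicRoot := by
  intro y z hyz
  by_contra! hlt
  have hy := cubicRoot_pos y
  have : cubicRoot y ^ 3 < cubicRoot z ^ 3 := pow_lt_pow_left₀ hlt hy.le (by norm_num)
  have := mul_le_mul (max_le_max_right 0 hyz) hlt.le hy.le (le_max_right z 0)
  linarith [cubicRoot_spec' y, cubicRoot_spec' z]

/-- Subtracting the two cubic equations leaves a factor `a - b`. The divisor involves only the fixed
point `z`, so the bound yields continuity there. -/
theorem abs_cubicRoot_sub_le (y z : ℝ) :
    |cubicRoot y - cubicRoot z| ≤ |max z 0 - max y 0| / cubicRoot z := by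
  have hy := cubicRoot_pos y
  have hz := cubicRoot_pos z
  have ey := cubicRoot_spec' y
  have ez := cubicRoot_spec' z
  have hY := le_max_right y 0
  generalize cubicRoot y = a at *
  generalize cubicRoot z = b at *
  generalize max y 0 = Y at *
  generalize max z 0 = Z at *
  have hS : 0 ≤ a ^ 2 + a * b + Y := by positivity
  have e : |a - b| * (a ^ 2 + a * b + Y + b ^ 2) = |Z - Y| * b := by
    calc |a - b| * (a ^ 2 + a * b + Y + b ^ 2)
        = |(a - b) * (a ^ 2 + a * b + Y + b ^ 2)| := by
          rw [abs_mul, abs_of_nonneg (by positivity : 0 ≤ a ^ 2 + a * b + Y + b ^ 2)]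
      _ = |(Z - Y) * b| := by
          congr 1
          linear_combination ey - ez
      _ = |Z - Y| * b := by rw [abs_mul, abs_of_pos hz]
  have : |a - b| * b * b ≤ |Z - Y| * b := by
    nlinarith [mul_nonneg (abs_nonneg (a - b)) hS]
  rw [le_div_iff₀ hz]
  exact le_of_mul_le_mul_right this hz

theorem cubicRoot_continuous : Continuous cubicRoot := by
  rw [continuous_iff_continuousAt]
  intro z
  rw [ContinuousAt, tendsto_iff_dist_tendsto_zero]
  refine squeeze_zero (fun _ => dist_nonneg) (fun y => abs_cubicRoot_sub_le y z) ?_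
  have : Continuous fun y => |max z 0 - max y 0| / cubicRoot z := by fun_prop
  simpa using this.tendsto z

/-- The solution `x > 0` of `(1 + k) * x ^ 3 = 1`, for `k > -1`. -/
noncomputable def cubeRootInv (k : ℝ) : ℝ := (1 + k) ^ (-(1 / 3) : ℝ)

theorem cubeRootInv_pos {k : ℝ} (hk : -1 < k) : 0 < cubeRootInv k :=
  Real.rpow_pos_of_pos (by linarith) _

theorem cubeRootInv_spec {k : ℝ} (hk : -1 < k) : (1 + k) * cubeRootInv k ^ 3 = 1 := by
  have h : 0 < 1 + k := by linarith
  have e : cubeRootInv k ^ 3 = (1 + k)⁻¹ := by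
    rw [cubeRootInv, ← Real.rpow_natCast, ← Real.rpow_mul h.le, ← Real.rpow_neg_one]
    norm_num
  rw [e, mul_inv_cancel₀ h.ne']

theorem cubeRootInv_eq_of_mul_cube {k x : ℝ} (hk : -1 < k) (hx : 0 < x) (e : (1 + k) * x ^ 3 = 1) :
    cubeRootInv k = x := by
  have h : 1 + k ≠ 0 := by linarith
  refine (pow_left_inj₀ (cubeRootInv_pos hk).le hx.le three_ne_zero).1 (mul_left_cancel₀ h ?_)
  rw [e, cubeRootInv_spec hk]

theorem cubeRootInv_zero : cubeRootInv 0 = 1 :=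
  cubeRootInv_eq_of_mul_cube (by norm_num) one_pos (by norm_num)

theorem cubeRootInv_neg_seven_eighths : cubeRootInv (-(7 / 8)) = 2 :=
  cubeRootInv_eq_of_mul_cube (by norm_num) two_pos (by norm_num)

theorem cubeRootInv_anti {k l : ℝ} (hk : -1 < k) (hkl : k ≤ l) : cubeRootInv l ≤ cubeRootInv k :=
  Real.rpow_le_rpow_of_nonpos (by linarith) (by linarith) (by norm_num)

theorem continuousOn_cubeRootInv_comp {f : ℝ → ℝ} {s : Set ℝ} (hf : ContinuousOn f s)
    (h : ∀ x ∈ s, -1 < f x) : ContinuousOn (fun x => cubeRootInv (f x)) s :=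
  ContinuousOn.rpow_const (f := fun x => 1 + f x) (continuousOn_const.add hf) fun x hx =>
    Or.inl (by linarith [h x hx])

/-- The value of `h` determined by `w = h r₁₂ r₃₄`. -/
noncomputable def multiplierOf (A B w : ℝ) : ℝ := w / (cubicRoot (w / A) * cubicRoot (w / B))

theorem multiplierOf_mul (A B w : ℝ) :
    multiplierOf A B w * (cubicRoot (w / A) * cubicRoot (w / B)) = w :=
  div_mul_cancel₀ _ (mul_pos (cubicRoot_pos _) (cubicRoot_pos _)).ne'

theorem multiplierOf_continuous (A B : ℝ) : Continuous (multiplierOf A B) := by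
  have h (C : ℝ) : Continuous fun w => cubicRoot (w / C) :=
    cubicRoot_continuous.comp (continuous_id.div_const C)
  exact continuous_id.div ((h A).mul (h B)) fun w =>
    (mul_pos (cubicRoot_pos _) (cubicRoot_pos _)).ne'

theorem multiplierOf_mono {A B w w' : ℝ} (hA : 0 < A) (hB : 0 < B) (hw : 0 ≤ w) (hww : w ≤ w') :
    multiplierOf A B w ≤ multiplierOf A B w' :=
  div_le_div₀ (hw.trans hww) hww (mul_pos (cubicRoot_pos _) (cubicRoot_pos _))
    (mul_le_mul (cubicRoot_antitone (by gcongr)) (cubicRoot_antitone (by gcongr))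
      (cubicRoot_pos _).le (cubicRoot_pos _).le)

theorem le_multiplierOf (A B : ℝ) {w : ℝ} (hw : 0 ≤ w) : w ≤ multiplierOf A B w :=
  le_div_self hw (mul_pos (cubicRoot_pos _) (cubicRoot_pos _))
    (mul_le_one₀ (cubicRoot_le_one _) (cubicRoot_pos _).le (cubicRoot_le_one _))

/-- The expression is `-F` along the curve. `A, B` are the mass products of the parallel sides, `C,
D` of the diagonals, `E, G` of the legs. -/
theorem exists_trapezoid_balance {A B C D E G : ℝ} (hA : 0 < A) (hB : 0 < B) (hC : 0 < C)
    (hD : 0 < D) (hE : 0 < E) (hG : 0 < G) :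
    ∃ w, 0 ≤ w ∧ multiplierOf A B w < C ∧ multiplierOf A B w < D ∧
      cubeRootInv (-(multiplierOf A B w / C)) ^ 2 + cubeRootInv (-(multiplierOf A B w / D)) ^ 2
        - cubeRootInv (multiplierOf A B w / E) ^ 2 - cubeRootInv (multiplierOf A B w / G) ^ 2
        - 2 * cubicRoot (w / A) * cubicRoot (w / B) = 0 := by
  have hH := multiplierOf_continuous A B
  have hmono := fun {w w' : ℝ} => multiplierOf_mono (w := w) (w' := w') hA hB
  have hle := fun {w : ℝ} => le_multiplierOf A B (w := w)
  have hH0 : multiplierOf A B 0 = 0 := by simp [multiplierOf]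
  generalize multiplierOf A B = H at *
  have hμ : 0 < min C D := lt_min hC hD
  have hμC := min_le_left C D
  have hμD := min_le_right C D
  have hμor := min_choice C D
  generalize min C D = μ at *
  -- The factor `7/8` makes one diagonal equal to 2 while keeping `H` below both poles; `w ≤ H w`
  -- ensures that this level is reached.
  obtain ⟨w₁, ⟨hw₁, -⟩, hHw₁⟩ := intermediate_value_Icc (by positivity : 0 ≤ 7 / 8 * μ)
    hH.continuousOn (show 7 / 8 * μ ∈ Set.Icc _ _ from
      ⟨by rw [hH0]; positivity, hle (by positivity)⟩)
  have hub : ∀ w ∈ Set.Icc 0 w₁, H w ≤ 7 / 8 * μ := fun w hw => hHw₁ ▸ hmono hw.1 hw.2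
  have hlb : ∀ w ∈ Set.Icc 0 w₁, 0 ≤ H w := fun w hw => hw.1.trans (hle hw.1)
  have hneg : ∀ {K : ℝ}, 0 < K → μ ≤ K → ∀ w ∈ Set.Icc 0 w₁, -1 < -(H w / K) := by
    intro K hK hμK w hw
    rw [neg_lt_neg_iff, div_lt_one hK]
    linarith [hub w hw]
  have hpos : ∀ {K : ℝ}, 0 < K → ∀ w ∈ Set.Icc 0 w₁, -1 < H w / K := by
    intro K hK w hw
    linarith [div_nonneg (hlb w hw) hK.le]
  have hroot (K : ℝ) : Continuous fun w => cubicRoot (w / K) :=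
    cubicRoot_continuous.comp (continuous_id.div_const K)
  have hHK (K : ℝ) : ContinuousOn (fun w => H w / K) (Set.Icc 0 w₁) :=
    (hH.div_const K).continuousOn
  have hcont : ContinuousOn (fun w => cubeRootInv (-(H w / C)) ^ 2 + cubeRootInv (-(H w / D)) ^ 2
      - cubeRootInv (H w / E) ^ 2 - cubeRootInv (H w / G) ^ 2
      - 2 * cubicRoot (w / A) * cubicRoot (w / B)) (Set.Icc 0 w₁) :=
    ((((continuousOn_cubeRootInv_comp (hHK C).neg (hneg hC hμC)).pow 2).add
      ((continuousOn_cubeRootInv_comp (hHK D).neg (hneg hD hμD)).pow 2)).sub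
      ((continuousOn_cubeRootInv_comp (hHK E) (hpos hE)).pow 2)).sub
      ((continuousOn_cubeRootInv_comp (hHK G) (hpos hG)).pow 2)|>.sub
      (((hroot A).const_mul 2).mul (hroot B)).continuousOn
  have hroot0 : cubicRoot 0 = 1 := by
    have := cubicRoot_spec le_rfl
    rw [zero_mul, add_zero] at this
    exact (pow_eq_one_iff_of_nonneg (cubicRoot_pos 0).le three_ne_zero).1 this
  have hw₁' : w₁ ∈ Set.Icc 0 w₁ := ⟨hw₁, le_rfl⟩
  have ge1 : ∀ {K : ℝ}, 0 < K → μ ≤ K → 1 ≤ cubeRootInv (-(H w₁ / K)) ^ 2 := by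
    intro K hK hμK
    refine one_le_pow₀ ?_
    rw [← cubeRootInv_zero]
    exact cubeRootInv_anti (hneg hK hμK w₁ hw₁') (by linarith [div_nonneg (hlb w₁ hw₁') hK.le])
  have le1 : ∀ {K : ℝ}, 0 < K → cubeRootInv (H w₁ / K) ^ 2 ≤ 1 := by
    intro K hK
    refine pow_le_one₀ (cubeRootInv_pos (hpos hK w₁ hw₁')).le ?_
    rw [← cubeRootInv_zero]
    exact cubeRootInv_anti (by norm_num) (div_nonneg (hlb w₁ hw₁') hK.le)
  have four : ∀ {K : ℝ}, 0 < K → μ = K → cubeRootInv (-(H w₁ / K)) ^ 2 = 4 := by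
    rintro _ hK rfl
    rw [hHw₁, mul_div_assoc, div_self hK.ne', mul_one, cubeRootInv_neg_seven_eighths]
    norm_num
  have hroots : cubicRoot (w₁ / A) * cubicRoot (w₁ / B) ≤ 1 :=
    mul_le_one₀ (cubicRoot_le_one _) (cubicRoot_pos _).le (cubicRoot_le_one _)
  -- The value is `-2` at 0, where all distances are 1, and at least `4 + 1 - 1 - 1 - 2 = 1` at
  -- `w₁`.
  obtain ⟨w, hw, e⟩ := intermediate_value_Icc hw₁ hcont (show (0 : ℝ) ∈ Set.Icc _ _ by
    constructor
    · simp [hH0, cubeRootInv_zero, hroot0]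
    · have := ge1 hC hμC
      have := ge1 hD hμD
      have := le1 hE
      have := le1 hG
      rcases hμor with h | h
      · linarith [four hC h]
      · linarith [four hD h])
  exact ⟨w, hw.1, by linarith [hub w hw], by linarith [hub w hw], e⟩

theorem trapezoidF_mk (a p t s q c : ℝ) :
    trapezoidF !₂[a, p, t, s, q, c] = 2 * a * c - p ^ 2 - q ^ 2 + s ^ 2 + t ^ 2 := rfl

theorem exists_isLagrangePoint_normalized {m : Fin 4 → ℝ} (hm : ∀ i, 0 < m i) :
    ∃ h r, IsLagrangePoint m 1 h r := by
  have hmm := fun i j => mul_pos (hm i) (hm j)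
  obtain ⟨w, hw, hC, hD, e⟩ := exists_trapezoid_balance (hmm 0 1) (hmm 2 3) (hmm 0 2) (hmm 1 3)
    (hmm 1 2) (hmm 0 3)
  have hh0 := hw.trans (le_multiplierOf (m 0 * m 1) (m 2 * m 3) hw)
  have hwh := multiplierOf_mul (m 0 * m 1) (m 2 * m 3) w
  generalize multiplierOf (m 0 * m 1) (m 2 * m 3) w = h at *
  have hneg : ∀ {K : ℝ}, 0 < K → h < K → -1 < -(h / K) := by
    intro K hK hhK
    rwa [neg_lt_neg_iff, div_lt_one hK]
  have hpos : ∀ {K : ℝ}, 0 < K → -1 < h / K := by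
    intro K hK
    linarith [div_nonneg hh0 hK.le]
  have hside : ∀ {K k x : ℝ}, 0 < K → (1 + k / K) * x ^ 3 = 1 →
      K * (1 - 1 * x ^ 3) = k * x ^ 3 := by
    intro K k x hK e
    have : K * ((1 + k / K) * x ^ 3) = (K + k) * x ^ 3 := by
      field_simp
    rw [e] at this
    linarith
  have hpar : ∀ {K : ℝ}, 0 < K →
      K * (1 - 1 * cubicRoot (w / K) ^ 3) = w * cubicRoot (w / K) := by
    intro K hK
    have e := cubicRoot_spec (div_nonneg hw hK.le)
    have : K * (w / K * cubicRoot (w / K)) = w * cubicRoot (w / K) := by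
      field_simp
    rw [← this]
    linear_combination -K * e
  refine ⟨h, !₂[cubicRoot (w / (m 0 * m 1)), cubeRootInv (-(h / (m 0 * m 2))),
    cubeRootInv (h / (m 0 * m 3)), cubeRootInv (h / (m 1 * m 2)),
    cubeRootInv (-(h / (m 1 * m 3))), cubicRoot (w / (m 2 * m 3))], ?_, ?_, ?_, ?_, ?_, ?_, ?_, ?_⟩
  · intro i
    fin_cases i
    · exact cubicRoot_pos _
    · exact cubeRootInv_pos (hneg (hmm 0 2) hC)
    · exact cubeRootInv_pos (hpos (hmm 0 3))
    · exact cubeRootInv_pos (hpos (hmm 1 2))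
    · exact cubeRootInv_pos (hneg (hmm 1 3) hD)
    · exact cubicRoot_pos _
  · rw [trapezoidF_mk]
    linear_combination -e
  · refine (hpar (hmm 0 1)).trans ?_
    -- Only the coefficient `w` is expanded to `h r₁₂ r₃₄`; those inside `cubicRoot` must stay.
    nth_rewrite 1 [← hwh]
    simp
    ring
  · refine (hpar (hmm 2 3)).trans ?_
    nth_rewrite 1 [← hwh]
    simp
    ring
  · refine hside (hmm 0 2) ?_
    rw [neg_div]
    exact cubeRootInv_spec (hneg (hmm 0 2) hC)
  · refine hside (hmm 1 3) ?_
    rw [neg_div]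
    exact cubeRootInv_spec (hneg (hmm 1 3) hD)
  · exact hside (hmm 1 2) (cubeRootInv_spec (hpos (hmm 1 2)))
  · exact hside (hmm 0 3) (cubeRootInv_spec (hpos (hmm 0 3)))

theorem exists_isCriticalPoint {m : Fin 4 → ℝ} (hm : ∀ i, 0 < m i) :
    ∃ r, IsCriticalPoint m r := by
  obtain ⟨h, r, hr⟩ := exists_isLagrangePoint_normalized hm
  have hI := inertia_pos hm hr.pos
  have ht : 0 < (√(inertia m r))⁻¹ := inv_pos.2 (Real.sqrt_pos.2 hI)
  refine ⟨(√(inertia m r))⁻¹ • r, (isCriticalPoint_iff hm _).2 ⟨?_, _, _, hr.smul ht⟩⟩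
  rw [inertia_smul, inv_pow, Real.sq_sqrt hI.le, inv_mul_cancel₀ hI.ne']

end TrapezoidalCC

theorem lemma5 (m : Fin 4 → ℝ) (hm : ∀ i, 0 < m i) :
    ∃! r : TrapezoidalCC.DistVec, TrapezoidalCC.IsCriticalPoint m r := by
  obtain ⟨r, hr⟩ := TrapezoidalCC.exists_isCriticalPoint hm
  exact ⟨r, hr, fun r' hr' => hr'.unique hm hr⟩
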